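/- **Theorem 4.** Let $n\ge 1$ and consider the heteroscedastic polynomial regression model on the design space $\mathcal X=(-1,1)$ in which the response $Y$ at $x$ is normally distributed with mean $\sum_{j=0}^n\theta_jx^j$ and variance $\sigma^2(x,\theta)=(1-x)^{-\theta_{n+1}-1}(1+x)^{-\theta_{n+2}-1}$. The parameter of interest is $\boldsymbol\theta_1=(\theta_0,\dots,\theta_n)^T\in\Theta_1\subset\mathbb R^{n+1}$ and the nuisance parameter is $\boldsymbol\theta_2=(\theta_{n+1},\theta_{n+2})^T\in\Theta_2\subset(0,\infty)^2$, where $\Theta_1,\Theta_2$ are measurable sets of finite positive Lebesgue measure and the two coordinate functions are integrable over $\Theta_2$ (for instance, compact sets of positive measure). A design $\xi$ is a probability measure on $\mathcal X$ with finite support. Let $I(x,\theta)$ be the Fisher information matrix of the model at $x$, let $M(\xi,\theta)=\int I(x,\theta)\,\xi(dx)$, and let $M_{22}(\xi,\theta)$ be the $2\times2$ diagonal block of $M(\xi,\theta)$ belonging to $\boldsymbol\theta_2$. The criterion for the Berger–Bernardo prior is $$\Phi_{BB}(\xi)=\int_{\Theta_1}\exp\Bigl\{\int_{\Theta_2}\frac{|M_{22}(\xi,\boldsymbol\theta_1,\boldsymbol\theta_2)|^{1/2}}{\int_{\Theta_2}|M_{22}(\xi,\boldsymbol\theta_1,\boldsymbol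 t_2)|^{1/2}d\boldsymbol t_2}\,\log\frac{|M(\xi,\boldsymbol\theta_1,\boldsymbol\theta_2)|^{1/2}}{|M_{22}(\xi,\boldsymbol\theta_1,\boldsymbol\theta_2)|^{1/2}}\,d\boldsymbol\theta_2\Bigr\}\,d\boldsymbol\theta_1 .$$ A Bayesian optimal $(n+1)$-point design with respect to the Berger–Bernardo prior is a maximizer of $\Phi_{BB}$ in the class of all designs with exactly $n+1$ support points for which $M(\xi,\theta)$ is nonsingular for all $\theta\in\Theta_1\times\Theta_2$, so that the criterion is defined (for $n\ge2$ all designs with $n+1$ support points have this property; for $n=1$ exactly those whose support does not contain $0$). Put $$g_j=\frac{\int_{\Theta_2}\theta_{n+j}\,d\boldsymbol\theta_2}{\int_{\Theta_2}d\boldsymbol\theta_2},\qquad j=1,2,$$ and, if $n=1$, assume that $P_2^{(g_1,g_2)}(0)\neq0$ (equivalently $(g_1-g_2)^2\ne g_1+g_2+4$). Then there is exactly one Bayesian optimal $(n+1)$-point design with respect to the Berger–Bernardo prior. Its support is the set of roots of the $(n+1)$th Jacobi polynomial $P_{n+1}^{(g_1,g_2)}$, and it puts mass $1/(n+1)$ at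 each of them. -/

import Mathlib

open MeasureTheory

noncomputable section

namespace BayesDesign

/-- An approximate design on `X`: a probability measure on `X` with finite support, given by its
finitely supported family of masses. -/
@[ext]
structure Design (X : Set ℝ) where
  /-- the mass put at each point -/
  mass : ℝ →₀ ℝ
  nonneg : ∀ x, 0 ≤ mass x
  sum_eq_one : (mass.sum fun _ w => w) = 1
  support_subset : ∀ x ∈ mass.support, x ∈ X

/-- The (finite) set of support points of a design. -/
def Design.support {X : Set ℝ} (ξ : Design X) : Finset ℝ := ξ.mass.support

/-- The `i`-th component of the score `∂/∂θ log p(y | θ, x)`, for a family of densities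
`p θ x y` in `y`. -/
def score {ι : Type*} [DecidableEq ι] (p : (ι → ℝ) → ℝ → ℝ → ℝ)
    (x : ℝ) (θ : ι → ℝ) (y : ℝ) (i : ι) : ℝ :=
  deriv (fun t : ℝ => Real.log (p (Function.update θ i t) x y)) (θ i)

/-- The Fisher information matrix at the experimental condition `x`,
`∫ (∂/∂θ log p(y | θ, x)) (∂/∂θ log p(y | θ, x))ᵀ p(y | θ, x) dy`. -/
def fisherInfo {ι : Type*} [DecidableEq ι] (p : (ι → ℝ) → ℝ → ℝ → ℝ)
    (x : ℝ) (θ : ι → ℝ) : Matrix ι ι ℝ :=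
  Matrix.of fun i j => ∫ y : ℝ, score p x θ y i * score p x θ y j * p θ x y

/-- The Fisher information matrix `M(ξ, θ) = ∫ I(x, θ) ξ(dx)` of the design `ξ`. -/
def infoMatrix {X : Set ℝ} {ι : Type*} [DecidableEq ι] (p : (ι → ℝ) → ℝ → ℝ → ℝ)
    (ξ : Design X) (θ : ι → ℝ) : Matrix ι ι ℝ :=
  ξ.mass.sum fun x w => w • fisherInfo p x θ

section Criterion

variable {X : Set ℝ} {κ₁ κ₂ : Type*} [Fintype κ₁] [Fintype κ₂] [DecidableEq κ₁] [DecidableEq κ₂]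

/-- `|M(ξ, θ₁, θ₂)|`. -/
def detM (p : (κ₁ ⊕ κ₂ → ℝ) → ℝ → ℝ → ℝ) (ξ : Design X) (θ₁ : κ₁ → ℝ) (θ₂ : κ₂ → ℝ) : ℝ :=
  (infoMatrix p ξ (Sum.elim θ₁ θ₂)).det

/-- `|M₂₂(ξ, θ₁, θ₂)|`, the determinant of the block belonging to the nuisance parameter. -/
def detM22 (p : (κ₁ ⊕ κ₂ → ℝ) → ℝ → ℝ → ℝ) (ξ : Design X) (θ₁ : κ₁ → ℝ) (θ₂ : κ₂ → ℝ) : ℝ :=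
  (infoMatrix p ξ (Sum.elim θ₁ θ₂)).toBlocks₂₂.det

/-- The conditional density `p^BB(θ₂ | θ₁, ξ)` on `Θ₂`: the Jeffreys prior of the nuisance
parameter for fixed parameter of interest. -/
def condPrior (p : (κ₁ ⊕ κ₂ → ℝ) → ℝ → ℝ → ℝ) (Θ₂ : Set (κ₂ → ℝ))
    (ξ : Design X) (θ₁ : κ₁ → ℝ) (θ₂ : κ₂ → ℝ) : ℝ :=
  Real.sqrt (detM22 p ξ θ₁ θ₂) / ∫ t₂ in Θ₂, Real.sqrt (detM22 p ξ θ₁ t₂)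

/-- The optimality criterion `Φ_BB` for the Berger-Bernardo prior, with parameter of interest
`θ₁ ∈ Θ₁` and nuisance parameter `θ₂ ∈ Θ₂`. -/
def criterionBB (p : (κ₁ ⊕ κ₂ → ℝ) → ℝ → ℝ → ℝ) (Θ₁ : Set (κ₁ → ℝ)) (Θ₂ : Set (κ₂ → ℝ))
    (ξ : Design X) : ℝ :=
  ∫ θ₁ in Θ₁, Real.exp (∫ θ₂ in Θ₂, condPrior p Θ₂ ξ θ₁ θ₂ *
    Real.log (Real.sqrt (detM p ξ θ₁ θ₂) / Real.sqrt (detM22 p ξ θ₁ θ₂)))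

/-- The information matrix of `ξ` is nonsingular on the whole parameter space. As information
matrices are positive semidefinite, then `|M| > 0` and `|M₂₂| > 0`, so that no quotient `0 / 0` and
no logarithm of `0` occurs in `criterionBB`. -/
def IsNonsingular (p : (κ₁ ⊕ κ₂ → ℝ) → ℝ → ℝ → ℝ) (Θ₁ : Set (κ₁ → ℝ)) (Θ₂ : Set (κ₂ → ℝ))
    (ξ : Design X) : Prop :=
  ∀ θ₁ ∈ Θ₁, ∀ θ₂ ∈ Θ₂, detM p ξ θ₁ θ₂ ≠ 0

/-- `ξ` is a Bayesian optimal `m`-point design with respect to the Berger-Bernardo prior: it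
maximizes `Φ_BB` in the class of all designs with `m` support points (for which the criterion is
defined). -/
def IsOptimalBB (p : (κ₁ ⊕ κ₂ → ℝ) → ℝ → ℝ → ℝ) (Θ₁ : Set (κ₁ → ℝ)) (Θ₂ : Set (κ₂ → ℝ))
    (m : ℕ) (ξ : Design X) : Prop :=
  ξ.support.card = m ∧ IsNonsingular p Θ₁ Θ₂ ξ ∧
    ∀ η : Design X, η.support.card = m → IsNonsingular p Θ₁ Θ₂ η →
      criterionBB p Θ₁ Θ₂ η ≤ criterionBB p Θ₁ Θ₂ ξ

end Criterion

/-- The variance function `(1 - x)^(-θ_{n+1} - 1) (1 + x)^(-θ_{n+2} - 1)`; the nuisance parameter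
`(θ_{n+1}, θ_{n+2})` is written `(θ₂ 0, θ₂ 1)`. -/
def variance (θ₂ : Fin 2 → ℝ) (x : ℝ) : ℝ :=
  (1 - x) ^ (-θ₂ 0 - 1) * (1 + x) ^ (-θ₂ 1 - 1)

/-- Polynomial regression of degree `n` on `(-1, 1)`: the response at `x` is normal with mean
`∑ j ≤ n, θ_j x^j` and variance `variance θ₂ x`. Parameter of interest: the `n + 1` coefficients;
nuisance parameter: the two parameters of the variance. -/
def polyDensity (n : ℕ) (θ : Fin (n + 1) ⊕ Fin 2 → ℝ) (x y : ℝ) : ℝ :=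
  ProbabilityTheory.gaussianPDFReal (∑ j : Fin (n + 1), θ (Sum.inl j) * x ^ (j : ℕ))
    (variance (fun k => θ (Sum.inr k)) x).toNNReal y

/-- The average `∫ θ_{n+j} dθ₂ / ∫ dθ₂` over the nuisance parameter space. -/
def nuisanceMean (Θ₂ : Set (Fin 2 → ℝ)) (j : Fin 2) : ℝ :=
  (∫ θ₂ in Θ₂, θ₂ j) / ∫ _θ₂ in Θ₂, (1 : ℝ)

open Polynomial in
/-- The Jacobi polynomial
`P_N^(α, β)(x) = ∑ k ≤ N, (N+α+β+1)_k (α+k+1)_{N-k} / (k! (N-k)!) ((x-1)/2)^k`,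
where `(a)_k = a (a+1) ⋯ (a+k-1)`. -/
def jacobi (N : ℕ) (α β : ℝ) : ℝ[X] :=
  ∑ k ∈ Finset.range (N + 1),
    C ((ascPochhammer ℝ k).eval (N + α + β + 1) * (ascPochhammer ℝ (N - k)).eval (α + k + 1) /
      (k.factorial * (N - k).factorial)) * (C (1 / 2) * (X - 1)) ^ k

end BayesDesign

end

/-! The Fisher information is block diagonal, since z and z² - 1 are uncorrelated for a standard
normal z. Because the log variance is linear in the shifted parameters θ₂ + 1, the nuisance block is
free of θ. Hence the conditional prior is uniform on Θ₂, and |M| / |M₂₂| is the determinant of the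
coefficient block. With n + 1 points that block is VᵀDV with a square Vandermonde matrix V, so its
log is affine in θ₂ and averaging over Θ₂ replaces θ₂ by (g₁, g₂). The criterion becomes an
increasing function of (sum of log masses) + (energy of the support), as `criterionBB_polyDensity`
states, and masses and support separate.

The masses are settled by log t ≤ t - 1 (`sum_log_le`). For the support, Stieltjes' argument
applies: a maximizer exists by compactness, and stationarity in each point is the Jacobi
differential equation for the nodal polynomial at its own zeros. A degree count makes the equation
an identity, whose polynomial solutions of degree at most n + 1 form a line. So every maximizer is
the root set of the Jacobi polynomial, which also gives uniqueness.

It remains to see that this design is admissible: two nonzero support points make the nuisance block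
nonsingular (`nuisanceInfo_det_ne_zero`). -/

namespace BayesDesign

open ProbabilityTheory

/-! ### Fisher information of the normal model -/

/-- The vector of derivatives of `-log (variance θ₂ x)` with respect to the nuisance parameter. -/
noncomputable def logVec (x : ℝ) : Fin 2 → ℝ := ![Real.log (1 - x), Real.log (1 + x)]

/-- The Fisher information about the logarithm of the variance in a normal model. -/
noncomputable def logVarInfo : ℝ := ∫ z, ((z ^ 2 - 1) / 2) ^ 2 ∂gaussianReal 0 1

lemma integrable_pow_gaussianReal (k : ℕ) : Integrable (fun z : ℝ => z ^ k) (gaussianReal 0 1) := by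
  have h := (memLp_id_gaussianReal' (μ := 0) (v := 1) (k : ENNReal) (by simp)).integrable_norm_pow'
  rw [← integrable_norm_iff (by fun_prop)]
  simpa using h

lemma integral_sq_gaussianReal : ∫ z, z ^ 2 ∂gaussianReal 0 1 = 1 := by
  have h := variance_fun_id_gaussianReal (μ := 0) (v := 1)
  rw [variance_eq_integral (by fun_prop), integral_id_gaussianReal] at h
  simpa using h

lemma integral_odd_gaussianReal : ∫ z, z * (z ^ 2 - 1) ∂gaussianReal 0 1 = 0 := by
  have h : ∫ z, z * (z ^ 2 - 1) ∂(gaussianReal 0 1).map (fun x => -x)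
      = ∫ z, z * (z ^ 2 - 1) ∂gaussianReal 0 1 := by
    rw [gaussianReal_map_neg, neg_zero]
  rw [integral_map (by fun_prop) (by fun_prop)] at h
  have h2 : ∫ z, -z * ((-z) ^ 2 - 1) ∂gaussianReal 0 1
      = -∫ z, z * (z ^ 2 - 1) ∂gaussianReal 0 1 := by
    rw [← integral_neg]; congr 1; ext z; ring
  linarith

/-- The integrand vanishes only at ±1, a null set. Positivity is all that is needed; the exact value
plays no role. -/
lemma logVarInfo_pos : 0 < logVarInfo := by
  have hnn : ∀ z : ℝ, 0 ≤ ((z ^ 2 - 1) / 2) ^ 2 := fun z => sq_nonneg _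
  have hint : Integrable (fun z : ℝ => ((z ^ 2 - 1) / 2) ^ 2) (gaussianReal 0 1) := by
    have := (((integrable_pow_gaussianReal 4).sub ((integrable_pow_gaussianReal 2).const_mul 2)).add
      (integrable_pow_gaussianReal 0)).div_const 4
    refine this.congr (ae_of_all _ fun z => ?_)
    simp only [Pi.add_apply, Pi.sub_apply]
    ring
  refine lt_of_le_of_ne (integral_nonneg hnn) fun h => ?_
  have h0 := (integral_eq_zero_iff_of_nonneg hnn hint).1 h.symm
  have hfin : gaussianReal 0 1 ({1, -1} : Set ℝ) = 0 := by
    have := nullSingletonClass_gaussianReal (μ := 0) (v := 1) one_ne_zero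
    exact Set.Finite.measure_zero (by simp) _
  have hae : ∀ᵐ z ∂gaussianReal 0 1, z ∈ ({1, -1} : Set ℝ) := by
    filter_upwards [h0] with z hz
    have : z ^ 2 = 1 := by
      have : ((z ^ 2 - 1) / 2) = 0 := by simpa using hz
      linarith
    simpa using this
  have := measure_mono_null (s := Set.univ) (t := {1, -1} ∪ {1,-1}ᶜ) (by simp)
    (measure_union_null hfin hae)
  simp at this

lemma variance_pos (θ₂ : Fin 2 → ℝ) {x : ℝ} (hx : x ∈ Set.Ioo (-1 : ℝ) 1) :
    0 < variance θ₂ x :=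
  mul_pos (Real.rpow_pos_of_pos (by linarith [hx.2]) _) (Real.rpow_pos_of_pos (by linarith [hx.1]) _)

lemma log_variance (θ₂ : Fin 2 → ℝ) {x : ℝ} (hx : x ∈ Set.Ioo (-1 : ℝ) 1) :
    Real.log (variance θ₂ x) = -∑ k, (θ₂ k + 1) * logVec x k := by
  have h1 : 0 < 1 - x := by linarith [hx.2]
  have h2 : 0 < 1 + x := by linarith [hx.1]
  rw [variance, Real.log_mul (Real.rpow_pos_of_pos h1 _).ne' (Real.rpow_pos_of_pos h2 _).ne',
    Real.log_rpow h1, Real.log_rpow h2]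
  simp [logVec]
  ring

lemma log_gaussianPDFReal (m : ℝ) {v : ℝ} (hv : 0 < v) (y : ℝ) :
    Real.log (gaussianPDFReal m v.toNNReal y)
      = -(Real.log (2 * Real.pi)) / 2 - Real.log v / 2 - (y - m) ^ 2 / 2 * Real.exp (-Real.log v) := by
  rw [gaussianPDFReal, Real.log_mul (by positivity) (by positivity), Real.log_inv,
    Real.log_sqrt (by positivity), Real.log_exp, Real.coe_toNNReal _ hv.le,
    Real.log_mul (by positivity) hv.ne', Real.exp_neg, Real.exp_log hv]
  field_simp
  ring

/-- In terms of the standardized residual z the score is z or (z² - 1) / 2 times a constant, so the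
Fisher integrals become standard normal moments. -/
lemma score_polyDensity (n : ℕ) {x : ℝ} (hx : x ∈ Set.Ioo (-1 : ℝ) 1)
    (θ : Fin (n + 1) ⊕ Fin 2 → ℝ) (y z : ℝ)
    (hy : y = Real.sqrt (variance (fun k => θ (Sum.inr k)) x) * z
      + ∑ j : Fin (n + 1), θ (Sum.inl j) * x ^ (j : ℕ)) (i : Fin (n + 1) ⊕ Fin 2) :
    score (polyDensity n) x θ y i =
      Sum.elim (fun j : Fin (n + 1) =>
          z * (x ^ (j : ℕ) / Real.sqrt (variance (fun k => θ (Sum.inr k)) x)))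
        (fun k => -((z ^ 2 - 1) / 2) * logVec x k) i := by
  have hv := variance_pos (fun k => θ (Sum.inr k)) hx
  set s := Real.sqrt (variance (fun k => θ (Sum.inr k)) x) with hs
  have hs0 : 0 < s := Real.sqrt_pos.2 hv
  have hsv : variance (fun k => θ (Sum.inr k)) x = s ^ 2 := (Real.sq_sqrt hv.le).symm
  set m := ∑ j : Fin (n + 1), θ (Sum.inl j) * x ^ (j : ℕ) with hm
  have hexp : Real.exp (-Real.log (variance (fun k => θ (Sum.inr k)) x)) = (s ^ 2)⁻¹ := by
    rw [Real.exp_neg, Real.exp_log hv, hsv]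
  have hsum {m' : ℕ} (f : Fin m' → ℝ) (g : Fin m' → ℝ) (i : Fin m') (t : ℝ) :
      ∑ j, Function.update f i t j * g j = ∑ j, f j * g j + (t - f i) * g i := by
    rw [← sub_eq_iff_eq_add', ← Finset.sum_sub_distrib, Finset.sum_eq_single i]
    · simp; ring
    · intro j _ hj; simp [hj]
    · simp
  unfold score
  rcases i with j | k
  · have hfun : (fun t : ℝ => Real.log (polyDensity n (Function.update θ (Sum.inl j) t) x y))
        = fun t => -(Real.log (2 * Real.pi)) / 2
          - Real.log (variance (fun k => θ (Sum.inr k)) x) / 2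
          - (y - (m + (t - θ (Sum.inl j)) * x ^ (j : ℕ))) ^ 2 / 2 * (s ^ 2)⁻¹ := by
      ext t
      unfold polyDensity
      have e1 : (fun k : Fin 2 => Function.update θ (Sum.inl j) t (Sum.inr k))
        = fun k => θ (Sum.inr k) := by ext k; simp
      have e2 : ∀ i : Fin (n + 1), Function.update θ (Sum.inl j) t (Sum.inl i)
        = Function.update (fun i => θ (Sum.inl i)) j t i := fun i => by
          simp [Function.update_apply]
      rw [e1, log_gaussianPDFReal _ hv, hexp]
      simp_rw [e2]
      rw [hsum (fun i => θ (Sum.inl i)) (fun i => x ^ (i : ℕ))]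
    rw [hfun]
    have hd : HasDerivAt (fun t => -(Real.log (2 * Real.pi)) / 2
          - Real.log (variance (fun k => θ (Sum.inr k)) x) / 2
          - (y - (m + (t - θ (Sum.inl j)) * x ^ (j : ℕ))) ^ 2 / 2 * (s ^ 2)⁻¹)
        (-((2 : ℕ) * (y - (m + (θ (Sum.inl j) - θ (Sum.inl j)) * x ^ (j : ℕ))) ^ (2 - 1)
          * (-(1 * x ^ (j : ℕ))) / 2 * (s ^ 2)⁻¹)) (θ (Sum.inl j)) := by
      refine HasDerivAt.const_sub _ (HasDerivAt.mul_const (HasDerivAt.div_const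
        (HasDerivAt.pow (HasDerivAt.const_sub _ (HasDerivAt.const_add _ 
          (HasDerivAt.mul_const ((hasDerivAt_id _).sub_const _) _))) 2) 2) _)
    rw [hd.deriv, hy]
    simp
    field_simp
  · have hfun : (fun t : ℝ => Real.log (polyDensity n (Function.update θ (Sum.inr k) t) x y))
        = fun t => -(Real.log (2 * Real.pi)) / 2
          - (Real.log (variance (fun k => θ (Sum.inr k)) x)
              - (t - θ (Sum.inr k)) * logVec x k) / 2
          - (y - m) ^ 2 / 2 * Real.exp (-(Real.log (variance (fun k => θ (Sum.inr k)) x)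
              - (t - θ (Sum.inr k)) * logVec x k)) := by
      ext t
      unfold polyDensity
      have e1 : (fun i : Fin 2 => Function.update θ (Sum.inr k) t (Sum.inr i))
        = Function.update (fun i => θ (Sum.inr i)) k t := by
          ext i; simp [Function.update_apply]
      have e2 : Real.log (variance (Function.update (fun i => θ (Sum.inr i)) k t) x)
          = Real.log (variance (fun k => θ (Sum.inr k)) x)
              - (t - θ (Sum.inr k)) * logVec x k := by
        rw [log_variance _ hx, log_variance _ hx]
        simp only [add_mul, Finset.sum_add_distrib]
        rw [hsum (fun i => θ (Sum.inr i)) (logVec x)]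
        ring
      rw [e1, log_gaussianPDFReal _ (variance_pos _ hx), e2]
      simp [← hm]
    rw [hfun]
    have hL : HasDerivAt (fun t => Real.log (variance (fun k => θ (Sum.inr k)) x)
              - (t - θ (Sum.inr k)) * logVec x k) (-(1 * logVec x k)) (θ (Sum.inr k)) :=
      HasDerivAt.const_sub _ (HasDerivAt.mul_const ((hasDerivAt_id _).sub_const _) _)
    have hd := ((hL.div_const 2).const_sub (-(Real.log (2 * Real.pi)) / 2)).sub
      (hL.neg.exp.const_mul ((y - m) ^ 2 / 2))
    erw [hd.deriv]
    simp only [sub_self, zero_mul, sub_zero, Pi.neg_apply, hexp, hy, Sum.elim_inr]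
    field_simp
    ring

lemma fisherInfo_polyDensity (n : ℕ) {x : ℝ} (hx : x ∈ Set.Ioo (-1 : ℝ) 1)
    (θ : Fin (n + 1) ⊕ Fin 2 → ℝ) :
    fisherInfo (polyDensity n) x θ = Matrix.fromBlocks
      (Matrix.of fun i j : Fin (n + 1) => x ^ (i : ℕ) * x ^ (j : ℕ) *
        (variance (fun k => θ (Sum.inr k)) x)⁻¹) 0 0
      (Matrix.of fun k l => logVarInfo * (logVec x k * logVec x l)) := by
  have hv := variance_pos (fun k => θ (Sum.inr k)) hx
  set s := Real.sqrt (variance (fun k => θ (Sum.inr k)) x) with hs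
  have hs0 : 0 < s := Real.sqrt_pos.2 hv
  have hsv : variance (fun k => θ (Sum.inr k)) x = s ^ 2 := (Real.sq_sqrt hv.le).symm
  set m := ∑ j : Fin (n + 1), θ (Sum.inl j) * x ^ (j : ℕ) with hm
  have hmap : gaussianReal m (variance (fun k => θ (Sum.inr k)) x).toNNReal
      = (gaussianReal 0 1).map (fun z => s * z + m) := by
    have : (fun z => s * z + m) = (fun z => z + m) ∘ (fun z => s * z) := rfl
    rw [this, ← Measure.map_map (by fun_prop) (by fun_prop)]
    erw [gaussianReal_map_const_mul, gaussianReal_map_add_const]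
    congr 1
    · simp
    · ext; simp [hsv, sq_nonneg]
  have hF (i j) : fisherInfo (polyDensity n) x θ i j
      = ∫ z, score (polyDensity n) x θ (s * z + m) i * score (polyDensity n) x θ (s * z + m) j
        ∂gaussianReal 0 1 := by
    have hmeas : MeasurableEmbedding (fun z => s * z + m) := by
      exact ((Homeomorph.mulLeft₀ s hs0.ne').trans (Homeomorph.addRight m)).measurableEmbedding
    rw [← hmeas.integral_map (g := fun y => score (polyDensity n) x θ y i *
      score (polyDensity n) x θ y j), ← hmap,
      integral_gaussianReal_eq_integral_smul (by simpa using hv)]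
    simp only [fisherInfo, Matrix.of_apply, smul_eq_mul]
    congr 1; ext y
    rw [mul_comm]; rfl
  have hS (z i) := score_polyDensity n hx θ (s * z + m) z rfl i
  ext i j
  rw [hF]
  simp_rw [hS]
  rcases i with i | i <;> rcases j with j | j
  · simp only [Sum.elim_inl, Matrix.fromBlocks_apply₁₁, Matrix.of_apply]
    rw [show (fun z => z * (x ^ (i : ℕ) / s) * (z * (x ^ (j : ℕ) / s)))
      = fun z => z ^ 2 * (x ^ (i : ℕ) * x ^ (j : ℕ) * (s ^ 2)⁻¹) by ext z; field_simp,
      integral_mul_const, integral_sq_gaussianReal, hsv, one_mul]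
  · simp only [Sum.elim_inl, Sum.elim_inr, Matrix.fromBlocks_apply₁₂, Matrix.zero_apply]
    rw [show (fun z => z * (x ^ (i : ℕ) / s) * (-((z ^ 2 - 1) / 2) * logVec x j))
      = fun z => (z * (z ^ 2 - 1)) * (-(x ^ (i : ℕ) / s / 2 * logVec x j)) by ext z; ring,
      integral_mul_const, integral_odd_gaussianReal, zero_mul]
  · simp only [Sum.elim_inl, Sum.elim_inr, Matrix.fromBlocks_apply₂₁, Matrix.zero_apply]
    rw [show (fun z => (-((z ^ 2 - 1) / 2) * logVec x i) * (z * (x ^ (j : ℕ) / s)))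
      = fun z => (z * (z ^ 2 - 1)) * (-(x ^ (j : ℕ) / s / 2 * logVec x i)) by ext z; ring,
      integral_mul_const, integral_odd_gaussianReal, zero_mul]
  · simp only [Sum.elim_inr, Matrix.fromBlocks_apply₂₂, Matrix.of_apply]
    rw [show (fun z => -((z ^ 2 - 1) / 2) * logVec x i * (-((z ^ 2 - 1) / 2) * logVec x j))
      = fun z => ((z ^ 2 - 1) / 2) ^ 2 * (logVec x i * logVec x j) by ext z; ring,
      integral_mul_const]
    rfl

/-! ### Energy and the Vandermonde determinant -/

/-- Minus the energy of the finite charge configuration `S ⊆ (-1, 1)` in Stieltjes' electrostatic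
model for the zeros of the Jacobi polynomials. -/
noncomputable def jacobiEnergy (α β : ℝ) (S : Finset ℝ) : ℝ :=
  ∑ x ∈ S, ((α + 1) * Real.log (1 - x) + (β + 1) * Real.log (1 + x))
    + ∑ x ∈ S, ∑ y ∈ S.erase x, Real.log (y - x)

lemma det_vandermonde_sq {m : ℕ} (v : Fin m → ℝ) :
    (Matrix.vandermonde v).det ^ 2 = ∏ i, ∏ j ∈ {i}ᶜ, |v j - v i| := by
  rw [← Finset.prod_prod_Ioi_mul_eq_prod_prod_off_diag fun j i => |v j - v i|,
    Matrix.det_vandermonde, ← Finset.prod_pow]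
  refine Finset.prod_congr rfl fun i _ => ?_
  rw [← Finset.prod_pow]
  refine Finset.prod_congr rfl fun j _ => ?_
  rw [abs_sub_comm (v i), ← sq, sq_abs]

/-- `Real.log` ignores signs, so the double sum counts each log distance twice, once per order; this
matches the square. -/
lemma log_det_vandermonde_sq {m : ℕ} {v : Fin m → ℝ} (hv : Function.Injective v) :
    Real.log ((Matrix.vandermonde v).det ^ 2) =
      ∑ x ∈ Finset.univ.image v, ∑ y ∈ (Finset.univ.image v).erase x, Real.log (y - x) := by
  have hne (i j) (h : j ∈ ({i}ᶜ : Finset (Fin m))) : |v j - v i| ≠ 0 := by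
    have : j ≠ i := by simpa using h
    simpa [sub_eq_zero] using hv.ne this
  rw [det_vandermonde_sq, Real.log_prod fun i _ => Finset.prod_ne_zero_iff.2 (hne i),
    Finset.sum_image hv.injOn]
  refine Finset.sum_congr rfl fun i _ => ?_
  rw [Real.log_prod (hne i), ← Finset.image_erase hv, Finset.sum_image hv.injOn,
    ← Finset.compl_singleton]
  simp

/-! ### The criterion in closed form -/

variable {n : ℕ}

lemma infoMatrix_polyDensity (ξ : Design (Set.Ioo (-1) 1)) (θ : Fin (n + 1) ⊕ Fin 2 → ℝ) :
    infoMatrix (polyDensity n) ξ θ = Matrix.fromBlocks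
      (Matrix.of fun i j : Fin (n + 1) => ∑ x ∈ ξ.support, x ^ (i : ℕ) *
        (ξ.mass x * (variance (fun k => θ (Sum.inr k)) x)⁻¹) * x ^ (j : ℕ)) 0 0
      (Matrix.of fun k l => ∑ x ∈ ξ.support,
        ξ.mass x * (logVarInfo * (logVec x k * logVec x l))) := by
  have h : infoMatrix (polyDensity n) ξ θ
      = ∑ x ∈ ξ.support, ξ.mass x • fisherInfo (polyDensity n) x θ := rfl
  rw [h, Finset.sum_congr rfl fun x hx => by
    rw [fisherInfo_polyDensity n (ξ.support_subset x hx)]]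
  ext i j
  rw [Matrix.sum_apply]
  rcases i with i | i <;> rcases j with j | j <;> simp
  exact Finset.sum_congr rfl fun x _ => by ring

/-- The information matrix of the nuisance parameter, which does not depend on any parameter. -/
noncomputable def nuisanceInfo (ξ : Design (Set.Ioo (-1) 1)) : Matrix (Fin 2) (Fin 2) ℝ :=
  Matrix.of fun k l => ∑ x ∈ ξ.support, ξ.mass x * (logVarInfo * (logVec x k * logVec x l))

lemma detM22_polyDensity (ξ : Design (Set.Ioo (-1) 1)) (θ₁ : Fin (n + 1) → ℝ) (θ₂ : Fin 2 → ℝ) :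
    detM22 (polyDensity n) ξ θ₁ θ₂ = (nuisanceInfo ξ).det := by
  rw [detM22, infoMatrix_polyDensity, Matrix.toBlocks_fromBlocks₂₂, nuisanceInfo]

lemma Design.mass_pos {X : Set ℝ} (ξ : Design X) {x : ℝ} (hx : x ∈ ξ.support) : 0 < ξ.mass x :=
  lt_of_le_of_ne (ξ.nonneg x) (Finsupp.mem_support_iff.1 hx).symm

lemma Design.sum_support {X : Set ℝ} (ξ : Design X) : ∑ x ∈ ξ.support, ξ.mass x = 1 :=
  ξ.sum_eq_one

/-- Cauchy–Schwarz for the two logarithms, with weights `ξ.mass x * logVarInfo`. -/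
lemma nuisanceInfo_det_nonneg (ξ : Design (Set.Ioo (-1) 1)) : 0 ≤ (nuisanceInfo ξ).det := by
  have h := Finset.sum_mul_sq_le_sq_mul_sq ξ.support
    (fun x => Real.sqrt (ξ.mass x * logVarInfo) * logVec x 0)
    (fun x => Real.sqrt (ξ.mass x * logVarInfo) * logVec x 1)
  have hs (x : ℝ) : Real.sqrt (ξ.mass x * logVarInfo) ^ 2 = ξ.mass x * logVarInfo :=
    Real.sq_sqrt (mul_nonneg (ξ.nonneg x) logVarInfo_pos.le)
  have e (k l) : ∑ x ∈ ξ.support, (Real.sqrt (ξ.mass x * logVarInfo) * logVec x k) *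
      (Real.sqrt (ξ.mass x * logVarInfo) * logVec x l) = nuisanceInfo ξ k l := by
    refine Finset.sum_congr rfl fun x _ => ?_
    linear_combination (logVec x k * logVec x l) * hs x
  rw [e] at h
  simp_rw [sq (_ * _)] at h
  rw [e, e] at h
  have hsymm : nuisanceInfo ξ 1 0 = nuisanceInfo ξ 0 1 :=
    Finset.sum_congr rfl fun x _ => by ring
  rw [Matrix.det_fin_two, hsymm]
  linarith [sq (nuisanceInfo ξ 0 1)]

/-- The determinant of the information matrix of the regression coefficients. -/
noncomputable def coeffDet (ξ : Design (Set.Ioo (-1) 1)) (θ₂ : Fin 2 → ℝ) {m : ℕ}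
    (h : ξ.support.card = m) : ℝ :=
  (∏ x ∈ ξ.support, (ξ.mass x * (variance θ₂ x)⁻¹)) *
    (Matrix.vandermonde (ξ.support.orderEmbOfFin h)).det ^ 2

lemma coeffDet_pos (ξ : Design (Set.Ioo (-1) 1)) (θ₂ : Fin 2 → ℝ) {m : ℕ}
    (h : ξ.support.card = m) : 0 < coeffDet ξ θ₂ h := by
  refine mul_pos (Finset.prod_pos fun x hx => mul_pos (ξ.mass_pos hx)
    (inv_pos.2 (variance_pos _ (ξ.support_subset x hx)))) (sq_pos_of_ne_zero ?_)
  exact Matrix.det_vandermonde_ne_zero_iff.2 (ξ.support.orderEmbOfFin h).injective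

/-- As many points as coefficients make the Vandermonde factor of the moment matrix square, so the
determinant is multiplicative. -/
lemma detM_polyDensity (ξ : Design (Set.Ioo (-1) 1)) (θ₁ : Fin (n + 1) → ℝ) (θ₂ : Fin 2 → ℝ)
    (h : ξ.support.card = n + 1) :
    detM (polyDensity n) ξ θ₁ θ₂ = coeffDet ξ θ₂ h * (nuisanceInfo ξ).det := by
  rw [detM, infoMatrix_polyDensity, Matrix.det_fromBlocks_zero₂₁, nuisanceInfo, coeffDet]
  congr 1
  set e := ξ.support.orderEmbOfFin h with he
  have himg : ξ.support = Finset.univ.map e.toEmbedding := by simp [he]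
  have hmat : (Matrix.of fun i j : Fin (n + 1) => ∑ x ∈ ξ.support, x ^ (i : ℕ) *
        (ξ.mass x * (variance θ₂ x)⁻¹) * x ^ (j : ℕ))
      = (Matrix.vandermonde e).transpose *
        (Matrix.diagonal (fun i => ξ.mass (e i) * (variance θ₂ (e i))⁻¹) * Matrix.vandermonde e) := by
    ext i j
    rw [Matrix.of_apply, Matrix.mul_apply]
    conv_lhs => rw [himg]
    refine (Finset.sum_map _ _ _).trans (Finset.sum_congr rfl fun k _ => ?_)
    simp [Matrix.diagonal_mul, mul_assoc]
  have hprod : ∏ x ∈ ξ.support, (ξ.mass x * (variance θ₂ x)⁻¹)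
      = ∏ i, (ξ.mass (e i) * (variance θ₂ (e i))⁻¹) := by
    conv_lhs => rw [himg]
    exact Finset.prod_map _ _ _
  simp only [Sum.elim_inr]
  rw [hmat, hprod, Matrix.det_mul, Matrix.det_mul, Matrix.det_transpose, Matrix.det_diagonal]
  ring

lemma log_coeffDet (ξ : Design (Set.Ioo (-1) 1)) (θ₂ : Fin 2 → ℝ) {m : ℕ}
    (h : ξ.support.card = m) :
    Real.log (coeffDet ξ θ₂ h) =
      ∑ x ∈ ξ.support, Real.log (ξ.mass x) + jacobiEnergy (θ₂ 0) (θ₂ 1) ξ.support := by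
  have hpos (x) (hx : x ∈ ξ.support) := variance_pos θ₂ (ξ.support_subset x hx)
  rw [coeffDet, Real.log_mul, Real.log_prod, log_det_vandermonde_sq
    (ξ.support.orderEmbOfFin h).injective, Finset.image_orderEmbOfFin_univ, jacobiEnergy,
    ← add_assoc]
  · refine congrArg (· + _) ?_
    rw [← Finset.sum_add_distrib]
    refine Finset.sum_congr rfl fun x hx => ?_
    rw [Real.log_mul (ξ.mass_pos hx).ne' (inv_pos.2 (hpos x hx)).ne', Real.log_inv,
      log_variance _ (ξ.support_subset x hx)]
    simp [logVec]
  · exact fun x hx => (mul_pos (ξ.mass_pos hx) (inv_pos.2 (hpos x hx))).ne'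
  · exact (Finset.prod_pos fun x hx => mul_pos (ξ.mass_pos hx) (inv_pos.2 (hpos x hx))).ne'
  · exact pow_ne_zero _
      (Matrix.det_vandermonde_ne_zero_iff.2 (ξ.support.orderEmbOfFin h).injective)

lemma isNonsingular_polyDensity_iff {Θ₁ : Set (Fin (n + 1) → ℝ)} {Θ₂ : Set (Fin 2 → ℝ)}
    (h₁ : Θ₁.Nonempty) (h₂ : Θ₂.Nonempty) {ξ : Design (Set.Ioo (-1) 1)}
    (h : ξ.support.card = n + 1) :
    IsNonsingular (polyDensity n) Θ₁ Θ₂ ξ ↔ (nuisanceInfo ξ).det ≠ 0 := by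
  obtain ⟨a, ha⟩ := h₁
  obtain ⟨b, hb⟩ := h₂
  refine ⟨fun H H0 => H a ha b hb ?_, fun H θ₁ _ θ₂ _ => ?_⟩
  · rw [detM_polyDensity _ _ _ h, H0, mul_zero]
  · rw [detM_polyDensity _ _ _ h]
    exact mul_ne_zero (coeffDet_pos _ _ h).ne' H

lemma criterionBB_polyDensity (Θ₁ : Set (Fin (n + 1) → ℝ)) {Θ₂ : Set (Fin 2 → ℝ)}
    (hΘ₂_pos : volume Θ₂ ≠ 0) (hΘ₂_fin : volume Θ₂ ≠ ⊤)
    (hΘ₂_int : ∀ j, IntegrableOn (fun θ₂ : Fin 2 → ℝ => θ₂ j) Θ₂)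
    {ξ : Design (Set.Ioo (-1) 1)} (h : ξ.support.card = n + 1)
    (hξ : (nuisanceInfo ξ).det ≠ 0) :
    criterionBB (polyDensity n) Θ₁ Θ₂ ξ = volume.real Θ₁ *
      Real.exp ((∑ x ∈ ξ.support, Real.log (ξ.mass x)
        + jacobiEnergy (nuisanceMean Θ₂ 0) (nuisanceMean Θ₂ 1) ξ.support) / 2) := by
  have hD : 0 < Real.sqrt (nuisanceInfo ξ).det :=
    Real.sqrt_pos.2 (lt_of_le_of_ne (nuisanceInfo_det_nonneg ξ) hξ.symm)
  have hV : 0 < volume.real Θ₂ := ENNReal.toReal_pos hΘ₂_pos hΘ₂_fin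
  set A := ∑ x ∈ ξ.support, Real.log (1 - x)
  set B := ∑ x ∈ ξ.support, Real.log (1 + x)
  set K := ∑ x ∈ ξ.support, ∑ y ∈ ξ.support.erase x, Real.log (y - x)
  set L := ∑ x ∈ ξ.support, Real.log (ξ.mass x)
  have hE (α β : ℝ) : jacobiEnergy α β ξ.support = (α + 1) * A + (β + 1) * B + K := by
    simp only [jacobiEnergy, Finset.sum_add_distrib, ← Finset.mul_sum, A, B, K]
  have hinner (θ₁ : Fin (n + 1) → ℝ) : ∫ θ₂ in Θ₂, condPrior (polyDensity n) Θ₂ ξ θ₁ θ₂ *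
      Real.log (Real.sqrt (detM (polyDensity n) ξ θ₁ θ₂) /
        Real.sqrt (detM22 (polyDensity n) ξ θ₁ θ₂))
      = (L + jacobiEnergy (nuisanceMean Θ₂ 0) (nuisanceMean Θ₂ 1) ξ.support) / 2 := by
    -- The nuisance determinant cancels from both factors, leaving the uniform density times half
    -- the log of `coeffDet`, which is affine in θ₂.
    have hpt (θ₂ : Fin 2 → ℝ) : condPrior (polyDensity n) Θ₂ ξ θ₁ θ₂ *
        Real.log (Real.sqrt (detM (polyDensity n) ξ θ₁ θ₂) /
          Real.sqrt (detM22 (polyDensity n) ξ θ₁ θ₂))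
        = (2 * volume.real Θ₂)⁻¹ * (L + A + B + K) + (2 * volume.real Θ₂)⁻¹ * A * θ₂ 0
          + (2 * volume.real Θ₂)⁻¹ * B * θ₂ 1 := by
      simp only [condPrior, detM22_polyDensity]
      rw [detM_polyDensity _ _ _ h, Real.sqrt_mul (coeffDet_pos _ _ h).le,
        mul_div_cancel_right₀ _ hD.ne', Real.log_sqrt (coeffDet_pos _ _ h).le, log_coeffDet, hE,
        setIntegral_const, smul_eq_mul]
      field_simp
      ring
    simp_rw [hpt]
    have i0 := (hΘ₂_int 0).const_mul ((2 * volume.real Θ₂)⁻¹ * A)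
    have i1 := (hΘ₂_int 1).const_mul ((2 * volume.real Θ₂)⁻¹ * B)
    have ic : IntegrableOn (fun _ : Fin 2 → ℝ => (2 * volume.real Θ₂)⁻¹ * (L + A + B + K)) Θ₂ :=
      integrableOn_const hΘ₂_fin
    have i2 : IntegrableOn (fun θ₂ : Fin 2 → ℝ => (2 * volume.real Θ₂)⁻¹ * (L + A + B + K)
        + (2 * volume.real Θ₂)⁻¹ * A * θ₂ 0) Θ₂ := ic.add i0
    rw [integral_add i2 i1, integral_add ic i0,
      integral_const_mul ((2 * volume.real Θ₂)⁻¹ * A),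
      integral_const_mul ((2 * volume.real Θ₂)⁻¹ * B), setIntegral_const, hE]
    simp only [nuisanceMean, setIntegral_const, smul_eq_mul, mul_one]
    field_simp
    ring
  simp only [criterionBB, hinner]
  rw [setIntegral_const, smul_eq_mul]

end BayesDesign

/-! ### Jacobi polynomials and their differential equation -/

namespace BayesDesign

open Polynomial

/-- The polynomial in `(x - 1) / 2` that defines the Jacobi polynomial. -/
noncomputable def jacobiAux (N : ℕ) (α β : ℝ) : ℝ[X] :=
  ∑ k ∈ Finset.range (N + 1),
    C ((ascPochhammer ℝ k).eval (N + α + β + 1) * (ascPochhammer ℝ (N - k)).eval (α + k + 1) /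
      (k.factorial * (N - k).factorial)) * X ^ k

lemma jacobi_eq_comp (N : ℕ) (α β : ℝ) :
    jacobi N α β = (jacobiAux N α β).comp (C (1 / 2) * (X - 1)) := by
  simp only [jacobi, jacobiAux, ← coe_compRingHom_apply, map_sum]
  simp

lemma coeff_jacobiAux {N k : ℕ} (α β : ℝ) (hk : k ≤ N) :
    (jacobiAux N α β).coeff k = (ascPochhammer ℝ k).eval (N + α + β + 1) *
      (ascPochhammer ℝ (N - k)).eval (α + k + 1) / (k.factorial * (N - k).factorial) := by
  simp only [jacobiAux, finsetSum_coeff, coeff_C_mul, coeff_X_pow, mul_ite, mul_one, mul_zero]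
  rw [Finset.sum_ite_eq, if_pos (Finset.mem_range.2 (by omega))]

lemma coeff_jacobiAux_of_lt {N k : ℕ} (α β : ℝ) (hk : N < k) :
    (jacobiAux N α β).coeff k = 0 := by
  simp only [jacobiAux, finsetSum_coeff, coeff_C_mul, coeff_X_pow, mul_ite, mul_one, mul_zero]
  rw [Finset.sum_ite_eq, if_neg (by simp; omega)]

/-- This two-term recurrence is the vanishing of the k-th coefficient in `coeff_jacobiOperator`. -/
lemma coeff_jacobiAux_succ {N k : ℕ} (α β : ℝ) (hk : k < N) :
    ((k : ℝ) + 1) * (k + α + 1) * (jacobiAux N α β).coeff (k + 1) =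
      (N - k) * (N + k + (α + β + 1)) * (jacobiAux N α β).coeff k := by
  obtain ⟨d, rfl⟩ : ∃ d, N = k + d + 1 := ⟨N - k - 1, by omega⟩
  rw [coeff_jacobiAux α β (by omega : k + 1 ≤ k + d + 1), coeff_jacobiAux α β (by omega),
    show k + d + 1 - (k + 1) = d by omega, show k + d + 1 - k = d + 1 by omega,
    ascPochhammer_succ_eval, ascPochhammer_succ_left, eval_mul, eval_comp, Nat.factorial_succ,
    Nat.factorial_succ]
  simp only [eval_X, eval_add, eval_one]
  push_cast
  rw [show α + (k + 1 : ℝ) + 1 = α + k + 1 + 1 by ring]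
  have h1 : (k.factorial : ℝ) ≠ 0 := by positivity
  have h2 : (d.factorial : ℝ) ≠ 0 := by positivity
  have h3 : (k : ℝ) + 1 ≠ 0 := by positivity
  have h4 : (d : ℝ) + 1 ≠ 0 := by positivity
  field_simp
  ring

lemma coeff_zero_jacobiAux_pos (N : ℕ) {α : ℝ} (β : ℝ) (hα : -1 < α) :
    0 < (jacobiAux N α β).coeff 0 := by
  rw [coeff_jacobiAux α β (Nat.zero_le _)]
  have := ascPochhammer_pos (N - 0) (α + (0 : ℕ) + 1) (by simp; linarith)
  simp only [ascPochhammer_zero, eval_one]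
  positivity

/-- The hypergeometric differential operator, whose kernel holds the Jacobi polynomials in the
variable `(x - 1) / 2`. -/
noncomputable def jacobiOperator (N : ℕ) (α β : ℝ) (h : ℝ[X]) : ℝ[X] :=
  (X + X ^ 2) * derivative (derivative h) + (C (α + 1) + C (α + β + 2) * X) * derivative h
    - C (N * (N + α + β + 1)) * h

lemma coeff_jacobiOperator (N : ℕ) (α β : ℝ) (h : ℝ[X]) (k : ℕ) :
    (jacobiOperator N α β h).coeff k = ((k : ℝ) + 1) * (k + α + 1) * h.coeff (k + 1)
      - (N - k) * (N + k + (α + β + 1)) * h.coeff k := by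
  have e : jacobiOperator N α β h = X * derivative (derivative h)
      + X * (X * derivative (derivative h)) + C (α + 1) * derivative h
      + C (α + β + 2) * (X * derivative h) - C (N * (N + α + β + 1)) * h := by
    rw [jacobiOperator]; ring
  rw [e]
  simp only [coeff_sub, coeff_add, coeff_C_mul]
  rcases k with _ | _ | k
  · simp only [coeff_derivative, mul_coeff_zero, coeff_X_zero, zero_mul]; push_cast; ring
  · simp [coeff_derivative, coeff_X_mul]; ring
  · simp only [coeff_derivative, coeff_X_mul]; push_cast; ring

/-- For α > -1 the factor (k + 1)(k + α + 1) never vanishes, so the recurrence determines all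
coefficients from the constant one. -/
lemma proportional_of_jacobiOperator_eq_zero {N : ℕ} {α : ℝ} (β : ℝ) (hα : -1 < α) {h : ℝ[X]}
    (hdeg : h.natDegree ≤ N) (h0 : jacobiOperator N α β h = 0) :
    C ((jacobiAux N α β).coeff 0) * h = C (h.coeff 0) * jacobiAux N α β := by
  ext k
  rw [coeff_C_mul, coeff_C_mul]
  rcases lt_or_ge N k with hk | hk
  · rw [coeff_jacobiAux_of_lt _ _ hk, coeff_eq_zero_of_natDegree_lt (p := h) (by omega)]
    simp
  induction k with
  | zero => ring
  | succ k ih =>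
    have e1 := coeff_jacobiAux_succ α β (show k < N by omega)
    have e2 := coeff_jacobiOperator N α β h k
    rw [h0, coeff_zero] at e2
    have hne : ((k : ℝ) + 1) * (k + α + 1) ≠ 0 := by
      have : (0 : ℝ) ≤ k := k.cast_nonneg
      exact mul_ne_zero (by linarith) (by linarith)
    refine mul_left_cancel₀ hne ?_
    linear_combination (N - k) * (N + k + (α + β + 1)) * ih (by omega)
      - (jacobiAux N α β).coeff 0 * e2 - h.coeff 0 * e1

/-- A set of `N` points whose nodal polynomial satisfies the Jacobi differential equation at these
points is the set of roots of the Jacobi polynomial of degree `N`. -/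
lemma roots_jacobi_of_ode {α : ℝ} (β : ℝ) (hα : -1 < α) (S : Finset ℝ)
    (hS : ∀ x ∈ S, (x ^ 2 - 1) * (derivative (derivative (∏ y ∈ S, (X - C y)))).eval x
      + (2 * (α + 1) + (α + β + 2) * (x - 1)) * (derivative (∏ y ∈ S, (X - C y))).eval x = 0) :
    (jacobi S.card α β).roots = S.val := by
  set f : ℝ[X] := ∏ y ∈ S, (X - C y) with hf
  have hfd : f.natDegree = S.card := by simp [hf]
  have hroot (x) (hx : x ∈ S) : f.eval x = 0 := by
    rw [hf, eval_prod]; exact Finset.prod_eq_zero hx (by simp)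
  -- The substitution x = 1 + 2X moves the singular points 1 and -1 to 0 and -1.
  set h : ℝ[X] := f.comp (1 + C 2 * X) with hh
  have hdeg : h.natDegree ≤ S.card := by
    rw [← hfd]
    refine natDegree_comp_le.trans ?_
    have : (1 + C 2 * X : ℝ[X]).natDegree ≤ 1 := by compute_degree
    exact (Nat.mul_le_mul_left _ this).trans (by simp)
  have hd1 : derivative h = C 2 * (derivative f).comp (1 + C 2 * X) := by
    rw [hh, derivative_comp]; simp
  have hd2 : derivative (derivative h) = C 4 * (derivative (derivative f)).comp (1 + C 2 * X) := by
    rw [hd1, derivative_C_mul, derivative_comp, show (4 : ℝ) = 2 * 2 by norm_num, C_mul]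
    simp [mul_assoc]
  have hback : h.comp (C (1 / 2) * (X - 1)) = f := by
    rw [hh, comp_assoc]
    have : (1 + C 2 * X : ℝ[X]).comp (C (1 / 2) * (X - 1)) = X := by
      simp only [add_comp, one_comp, mul_comp, C_comp, X_comp]
      rw [← mul_assoc, ← C_mul]
      norm_num
    rw [this, comp_X]
  -- The factor N - k kills the coefficient of degree N, so the image has degree below N = `S.card`.
  -- It vanishes at the N nodes, where the zeroth-order term drops out; hence it is zero.
  have hop : jacobiOperator S.card α β h = 0 := by
    refine eq_zero_of_degree_lt_of_eval_index_eq_zero (s := S) (v := fun x : ℝ => (x - 1) / 2) ?_ ?_ ?_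
    · intro x _ y _ hxy
      have : (x - 1) / 2 = (y - 1) / 2 := hxy
      linarith
    · refine (degree_lt_iff_coeff_zero _ _).2 fun k hk => ?_
      rw [coeff_jacobiOperator, coeff_eq_zero_of_natDegree_lt (n := k + 1) (by omega)]
      rcases hk.eq_or_lt with rfl | hk
      · simp
      · rw [coeff_eq_zero_of_natDegree_lt (by omega)]; simp
    · intro x hx
      have e : (1 : ℝ) + 2 * ((x - 1) / 2) = x := by ring
      rw [jacobiOperator, hd2, hd1, hh]
      simp only [eval_sub, eval_add, eval_mul, eval_comp, eval_X,
        eval_C, eval_pow, eval_one, e, hroot x hx]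
      linear_combination hS x hx
  have hprop := proportional_of_jacobiOperator_eq_zero β hα hdeg hop
  have hc := (coeff_zero_jacobiAux_pos S.card β hα).ne'
  have hprop' : C ((jacobiAux S.card α β).coeff 0) * f = C (h.coeff 0) * jacobi S.card α β := by
    have := congrArg (fun p : ℝ[X] => p.comp (C (1 / 2) * (X - 1))) hprop
    simpa only [mul_comp, C_comp, hback, ← jacobi_eq_comp] using this
  have hf0 : f ≠ 0 := Finset.prod_ne_zero_iff.2 fun y _ => X_sub_C_ne_zero y
  have hh0 : h.coeff 0 ≠ 0 := by
    intro h0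
    rw [h0, C_0, zero_mul] at hprop'
    exact mul_ne_zero (C_ne_zero.2 hc) hf0 hprop'
  have := congrArg roots hprop'
  rw [roots_C_mul _ hc, roots_C_mul _ hh0, hf, roots_prod_X_sub_C] at this
  exact this.symm

end BayesDesign

/-! ### Stieltjes' extremal problem -/

namespace BayesDesign

open Polynomial

/-- The left side is continuous on the whole closed cube, including collisions and endpoints where
the energy should be -∞; this makes compactness usable. -/
lemma exp_jacobiEnergy {N : ℕ} (α β : ℝ) {v : Fin N → ℝ} (hv : Function.Injective v)
    (hmem : ∀ i, v i ∈ Set.Ioo (-1 : ℝ) 1) :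
    (∏ i, ((1 - v i) ^ (α + 1) * (1 + v i) ^ (β + 1))) * (Matrix.vandermonde v).det ^ 2
      = Real.exp (jacobiEnergy α β (Finset.univ.image v)) := by
  have hdet : 0 < (Matrix.vandermonde v).det ^ 2 :=
    sq_pos_of_ne_zero (Matrix.det_vandermonde_ne_zero_iff.2 hv)
  rw [jacobiEnergy, Real.exp_add, ← log_det_vandermonde_sq hv, Real.exp_log hdet,
    Finset.sum_image hv.injOn, Real.exp_sum]
  congr 1
  refine Finset.prod_congr rfl fun i _ => ?_
  have h1 : 0 < 1 - v i := by linarith [(hmem i).2]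
  have h2 : 0 < 1 + v i := by linarith [(hmem i).1]
  rw [Real.exp_add, Real.rpow_def_of_pos h1, Real.rpow_def_of_pos h2, mul_comm (α + 1),
    mul_comm (β + 1)]

/-- The energy has a maximizer among the sets of `N` points. -/
lemma exists_forall_jacobiEnergy_le (N : ℕ) {α β : ℝ} (hα : -1 < α) (hβ : -1 < β) :
    ∃ S : Finset ℝ, S.card = N ∧ (∀ x ∈ S, x ∈ Set.Ioo (-1 : ℝ) 1) ∧
      ∀ T : Finset ℝ, T.card = N → (∀ x ∈ T, x ∈ Set.Ioo (-1 : ℝ) 1) →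
        jacobiEnergy α β T ≤ jacobiEnergy α β S := by
  set W : (Fin N → ℝ) → ℝ := fun v =>
    (∏ i, ((1 - v i) ^ (α + 1) * (1 + v i) ^ (β + 1))) * (Matrix.vandermonde v).det ^ 2 with hW
  have hcont : Continuous W := by
    refine Continuous.mul (continuous_finsetProd _ fun i _ => ?_) ?_
    · exact ((continuous_const.sub (continuous_apply i)).rpow_const fun _ => Or.inr (by linarith)).mul
        ((continuous_const.add (continuous_apply i)).rpow_const fun _ => Or.inr (by linarith))
    · refine (Continuous.matrix_det ?_).pow 2
      exact continuous_matrix fun i j => (continuous_apply i).pow _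
  have hexp {v : Fin N → ℝ} (hv : Function.Injective v) (hm : ∀ i, v i ∈ Set.Ioo (-1 : ℝ) 1) :
      W v = Real.exp (jacobiEnergy α β (Finset.univ.image v)) := exp_jacobiEnergy α β hv hm
  obtain ⟨v, hvK, hmax⟩ := (isCompact_Icc (a := fun _ : Fin N => (-1 : ℝ)) (b := fun _ => 1)).exists_isMaxOn
    ⟨0, by simp [Pi.le_def]⟩ hcont.continuousOn
  have hle {w : Fin N → ℝ} (hm : ∀ i, w i ∈ Set.Ioo (-1 : ℝ) 1) : W w ≤ W v :=
    hmax ⟨fun i => (hm i).1.le, fun i => (hm i).2.le⟩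
  -- Comparison with the distinct interior points i / (N + 1). Positivity then forces the maximizer
  -- to have distinct coordinates away from ±1, as α + 1 and β + 1 are positive.
  have hWv : 0 < W v := by
    have hN : (0 : ℝ) < N + 1 := by positivity
    have hm (i : Fin N) : (i : ℝ) / (N + 1) ∈ Set.Ioo (-1 : ℝ) 1 := by
      have : (0 : ℝ) ≤ (i : ℝ) / (N + 1) := by positivity
      refine ⟨by linarith, (div_lt_one hN).2 ?_⟩
      have : (i : ℝ) < N := by exact_mod_cast i.2
      linarith
    refine lt_of_lt_of_le ?_ (hle hm)
    rw [hexp (fun i j hij => ?_) hm]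
    · exact Real.exp_pos _
    · exact Fin.ext (by exact_mod_cast (div_left_inj' hN.ne').1 hij)
  have hinj : Function.Injective v := by
    refine Matrix.det_vandermonde_ne_zero_iff.1 fun h => ?_
    simp [hW, h] at hWv
  have hmem (i) : v i ∈ Set.Ioo (-1 : ℝ) 1 := by
    refine ⟨lt_of_le_of_ne (hvK.1 i) fun h => ?_, lt_of_le_of_ne (hvK.2 i) fun h => ?_⟩ <;>
      refine hWv.ne' (mul_eq_zero_of_left (Finset.prod_eq_zero (Finset.mem_univ i) ?_) _)
    · rw [← h, add_neg_cancel, Real.zero_rpow (by linarith : β + 1 ≠ 0), mul_zero]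
    · rw [h, sub_self, Real.zero_rpow (by linarith : α + 1 ≠ 0), zero_mul]
  refine ⟨Finset.univ.image v, by simp [Finset.card_image_of_injective _ hinj], by simpa using hmem,
    fun T hT hTm => ?_⟩
  have hTi := hle fun i => hTm _ (T.orderEmbOfFin_mem hT i)
  rwa [hexp (T.orderEmbOfFin hT).injective fun i => hTm _ (T.orderEmbOfFin_mem hT i),
    hexp hinj hmem, Real.exp_le_exp, Finset.image_orderEmbOfFin_univ] at hTi

/-- Isolates the dependence on one point; the 2 arises because each pair is counted in both orders.
-/
lemma jacobiEnergy_insert (α β : ℝ) {R : Finset ℝ} {t : ℝ} (ht : t ∉ R) :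
    jacobiEnergy α β (insert t R) = jacobiEnergy α β R
      + ((α + 1) * Real.log (1 - t) + (β + 1) * Real.log (1 + t)
        + 2 * Real.log ((∏ y ∈ R, (X - C y)).eval t)) := by
  have hlog : Real.log ((∏ y ∈ R, (X - C y)).eval t) = ∑ y ∈ R, Real.log (y - t) := by
    rw [eval_prod, Real.log_prod]
    · refine Finset.sum_congr rfl fun y _ => ?_
      rw [← Real.log_neg_eq_log]; simp
    · intro y hy h
      simp only [eval_sub, eval_X, eval_C, sub_eq_zero] at h
      exact ht (h ▸ hy)
  have hcross : ∑ x ∈ R, ∑ y ∈ (insert t R).erase x, Real.log (y - x)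
      = ∑ x ∈ R, ∑ y ∈ R.erase x, Real.log (y - x) + ∑ x ∈ R, Real.log (x - t) := by
    rw [← Finset.sum_add_distrib]
    refine Finset.sum_congr rfl fun x hx => ?_
    have hxt : t ≠ x := fun h => ht (h ▸ hx)
    rw [Finset.erase_insert_of_ne hxt, Finset.sum_insert (fun h => ht (Finset.mem_of_mem_erase h)),
      add_comm, ← Real.log_neg_eq_log (t - x), neg_sub]
  rw [jacobiEnergy, jacobiEnergy, Finset.sum_insert ht, Finset.sum_insert ht,
    Finset.erase_insert ht, hcross, hlog]
  ring

/-- Stieltjes: the points of maximal energy are the zeros of the Jacobi polynomial. -/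
lemma roots_jacobi_of_forall_jacobiEnergy_le {α : ℝ} (β : ℝ) (hα : -1 < α) {S : Finset ℝ}
    (hS : ∀ x ∈ S, x ∈ Set.Ioo (-1 : ℝ) 1)
    (hmax : ∀ T : Finset ℝ, T.card = S.card → (∀ x ∈ T, x ∈ Set.Ioo (-1 : ℝ) 1) →
      jacobiEnergy α β T ≤ jacobiEnergy α β S) :
    (jacobi S.card α β).roots = S.val := by
  refine roots_jacobi_of_ode β hα S fun x hx => ?_
  set q : ℝ[X] := ∏ y ∈ S.erase x, (X - C y) with hq
  have hfq : ∏ y ∈ S, (X - C y) = (X - C x) * q := (Finset.mul_prod_erase _ _ hx).symm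
  have h1 : 0 < 1 - x := by linarith [(hS x hx).2]
  have h2 : 0 < 1 + x := by linarith [(hS x hx).1]
  have hq0 : q.eval x ≠ 0 := by
    rw [hq, eval_prod, Finset.prod_ne_zero_iff]
    intro y hy
    simpa [sub_eq_zero] using (Finset.ne_of_mem_erase hy).symm
  -- Only x moves while the other points stay fixed, so their own energy cancels.
  have hloc : IsLocalMax (fun t => (α + 1) * Real.log (1 - t) + (β + 1) * Real.log (1 + t)
        + 2 * Real.log (q.eval t)) x := by
    have hev : ∀ᶠ t in nhds x, t ∉ S.erase x :=
      ((S.erase x).finite_toSet.isClosed.isOpen_compl).mem_nhds (by simp)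
    filter_upwards [hev, Ioo_mem_nhds (hS x hx).1 (hS x hx).2] with t ht htI
    have := hmax (insert t (S.erase x))
      (by rw [Finset.card_insert_of_notMem ht, Finset.card_erase_add_one hx])
      (fun y hy => (Finset.mem_insert.1 hy).elim (fun h => h ▸ htI)
        fun h => hS y (Finset.mem_of_mem_erase h))
    conv_rhs at this => rw [← Finset.insert_erase hx]
    rw [jacobiEnergy_insert α β ht, jacobiEnergy_insert α β (Finset.notMem_erase x S)] at this
    exact le_of_add_le_add_left this
  have hder := hloc.hasDerivAt_eq_zero
    ((((((hasDerivAt_id x).const_sub 1).log h1.ne').const_mul (α + 1)).add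
      ((((hasDerivAt_id x).const_add 1).log h2.ne').const_mul (β + 1))).add
      (((q.hasDerivAt x).log hq0).const_mul 2))
  simp only [id] at hder
  rw [hfq]
  simp only [derivative_mul, derivative_add, derivative_sub, derivative_X, derivative_C, sub_zero,
    eval_add, eval_mul, eval_sub, eval_X, eval_C, sub_self, zero_mul, one_mul, add_zero]
  -- For f = (X - x) q one has f'(x) = q(x) and f''(x) = 2 q'(x), so clearing denominators gives the
  -- differential equation at x.
  field_simp at hder
  linear_combination -hder

/-! ### Nonsingularity of the nuisance block -/

/-- By Rolle the derivative vanishes at two distinct points c, but its zeros solve the affine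
equation b - a = (a + b) c. Hence a + b = 0 and a = b. -/
lemma eq_zero_of_log_combination_eq_zero {a b p q r : ℝ} (hp : -1 < p) (hpq : p < q) (hqr : q < r)
    (hr : r < 1) (h : ∀ t ∈ ({p, q, r} : Set ℝ), a * Real.log (1 - t) + b * Real.log (1 + t) = 0) :
    a = 0 ∧ b = 0 := by
  have hder (t : ℝ) (h1 : -1 < t) (h2 : t < 1) :
      HasDerivAt (fun t => a * Real.log (1 - t) + b * Real.log (1 + t))
        (a * (-1 / (1 - t)) + b * (1 / (1 + t))) t :=
    ((((hasDerivAt_id t).const_sub 1).log (by simp; linarith)).const_mul a).add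
      ((((hasDerivAt_id t).const_add 1).log (by simp; linarith)).const_mul b)
  have hrolle (s u : ℝ) (hs : -1 < s) (hsu : s < u) (hu : u < 1)
      (h0 : a * Real.log (1 - s) + b * Real.log (1 + s) = a * Real.log (1 - u) + b * Real.log (1 + u)) :
      ∃ c ∈ Set.Ioo s u, b - a = (a + b) * c := by
    obtain ⟨c, hc, hc0⟩ := exists_hasDerivAt_eq_zero hsu
      (fun t ht => (hder t (by linarith [ht.1]) (by linarith [ht.2])).continuousAt.continuousWithinAt)
      h0 (fun t ht => hder t (by linarith [ht.1]) (by linarith [ht.2]))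
    refine ⟨c, hc, ?_⟩
    have h1 : 1 - c ≠ 0 := by linarith [hc.2]
    have h2 : 1 + c ≠ 0 := by linarith [hc.1]
    field_simp at hc0
    linear_combination hc0
  have h3 := h p (by simp)
  have h4 := h q (by simp)
  have h5 := h r (by simp)
  obtain ⟨c, hc, hce⟩ := hrolle p q hp hpq (by linarith) (by rw [h3, h4])
  obtain ⟨d, hd, hde⟩ := hrolle q r (by linarith) hqr hr (by rw [h4, h5])
  have hab : a + b = 0 := by
    have : (a + b) * (d - c) = 0 := by linear_combination hce - hde
    exact (mul_eq_zero.1 this).resolve_right (by linarith [hc.2, hd.1])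
  rw [hab] at hce
  constructor <;> linarith

/-- A kernel vector gives a zero quadratic form, hence a combination of log(1 - t) and log(1 + t)
vanishing on the support. It also vanishes at 0, which supplies the third zero. -/
lemma nuisanceInfo_det_ne_zero {ξ : Design (Set.Ioo (-1) 1)} {x y : ℝ} (hx : x ∈ ξ.support)
    (hy : y ∈ ξ.support) (hx0 : x ≠ 0) (hy0 : y ≠ 0) (hxy : x ≠ y) : (nuisanceInfo ξ).det ≠ 0 := by
  intro h
  obtain ⟨v, hv0, hv⟩ := Matrix.exists_mulVec_eq_zero_iff.2 h
  have hsum : ∑ t ∈ ξ.support, ξ.mass t * logVarInfo *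
      (v 0 * Real.log (1 - t) + v 1 * Real.log (1 + t)) ^ 2 = 0 := by
    have e : ∑ t ∈ ξ.support, ξ.mass t * logVarInfo *
        (v 0 * Real.log (1 - t) + v 1 * Real.log (1 + t)) ^ 2 = v ⬝ᵥ (nuisanceInfo ξ).mulVec v := by
      simp only [dotProduct, Matrix.mulVec, nuisanceInfo, Matrix.of_apply, Fin.sum_univ_two,
        Finset.sum_mul, Finset.mul_sum, mul_add, ← Finset.sum_add_distrib]
      refine Finset.sum_congr rfl fun t _ => ?_
      simp [logVec]
      ring
    rw [e, hv, dotProduct_zero]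
  have hz (t) (ht : t ∈ ξ.support) : v 0 * Real.log (1 - t) + v 1 * Real.log (1 + t) = 0 := by
    have := (Finset.sum_eq_zero_iff_of_nonneg fun t _ =>
      mul_nonneg (mul_nonneg (ξ.nonneg t) logVarInfo_pos.le) (sq_nonneg _)).1 hsum t ht
    simpa [(ξ.mass_pos ht).ne', logVarInfo_pos.ne'] using this
  have h0 : v 0 * Real.log (1 - 0) + v 1 * Real.log (1 + 0) = 0 := by simp
  have hzx := hz x hx
  have hzy := hz y hy
  have hxI := ξ.support_subset x hx
  have hyI := ξ.support_subset y hy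
  have hkey (p q r : ℝ) (hp : -1 < p) (hpq : p < q) (hqr : q < r) (hr : r < 1)
      (h1 : v 0 * Real.log (1 - p) + v 1 * Real.log (1 + p) = 0)
      (h2 : v 0 * Real.log (1 - q) + v 1 * Real.log (1 + q) = 0)
      (h3 : v 0 * Real.log (1 - r) + v 1 * Real.log (1 + r) = 0) : False := by
    obtain ⟨ha, hb⟩ := eq_zero_of_log_combination_eq_zero hp hpq hqr hr
      (by rintro t (rfl | rfl | rfl) <;> assumption)
    refine hv0 ?_
    ext k
    fin_cases k <;> assumption
  rcases hx0.lt_or_gt with hx1 | hx1 <;> rcases hy0.lt_or_gt with hy1 | hy1 <;>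
    rcases hxy.lt_or_gt with hxy1 | hxy1
  · exact hkey x y 0 hxI.1 hxy1 hy1 one_pos hzx hzy h0
  · exact hkey y x 0 hyI.1 hxy1 hx1 one_pos hzy hzx h0
  · exact hkey x 0 y hxI.1 hx1 hy1 hyI.2 hzx h0 hzy
  · linarith
  · linarith
  · exact hkey y 0 x hyI.1 hy1 hx1 hxI.2 hzy h0 hzx
  · exact hkey 0 x y (by norm_num) hx1 hxy1 hyI.2 h0 hzx hzy
  · exact hkey 0 y x (by norm_num) hy1 hxy1 hxI.2 h0 hzy hzx

/-! ### Optimality of uniform masses -/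

lemma exists_uniform_design {X : Set ℝ} {S : Finset ℝ} (hS : S.Nonempty) (hX : ∀ x ∈ S, x ∈ X) :
    ∃ ξ : Design X, ξ.support = S ∧ ∀ x ∈ S, ξ.mass x = 1 / (S.card : ℝ) := by
  have hc : (0 : ℝ) < S.card := by exact_mod_cast hS.card_pos
  let f : ℝ →₀ ℝ := Finsupp.indicator S fun _ _ => 1 / (S.card : ℝ)
  have hf (x) (hx : x ∈ S) : f x = 1 / (S.card : ℝ) := Finsupp.indicator_of_mem hx _
  have hf0 (x) (hx : x ∉ S) : f x = 0 := Finsupp.indicator_of_notMem hx _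
  have hsupp : f.support = S := by
    ext x
    rw [Finsupp.mem_support_iff]
    by_cases hx : x ∈ S
    · rw [hf x hx]; simp [hx, hc.ne']
    · rw [hf0 x hx]; simp [hx]
  refine ⟨⟨f, fun x => ?_, ?_, fun x hx => hX x (hsupp ▸ hx)⟩, hsupp, hf⟩
  · by_cases hx : x ∈ S
    · rw [hf x hx]; positivity
    · rw [hf0 x hx]
  · rw [Finsupp.sum, hsupp, Finset.sum_congr rfl hf]
    simp [hc.ne']

/-- Sum log t ≤ t - 1 over t = N w(x) with N = `S.card`: the right sides add up to 0, and the
inequality is strict unless t = 1. -/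
lemma sum_log_le {S : Finset ℝ} {w : ℝ → ℝ} (hw : ∀ x ∈ S, 0 < w x) (h1 : ∑ x ∈ S, w x = 1) :
    ∑ x ∈ S, Real.log (w x) ≤ S.card * Real.log (1 / S.card) ∧
      (∑ x ∈ S, Real.log (w x) = S.card * Real.log (1 / S.card) →
        ∀ x ∈ S, w x = 1 / (S.card : ℝ)) := by
  have hne : S.Nonempty := Finset.nonempty_iff_ne_empty.2 fun h => by simp [h] at h1
  have hc : (0 : ℝ) < S.card := by exact_mod_cast hne.card_pos
  have hle (x) (hx : x ∈ S) : Real.log (S.card * w x) ≤ S.card * w x - 1 :=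
    Real.log_le_sub_one_of_pos (mul_pos hc (hw x hx))
  have hl : ∑ x ∈ S, Real.log (S.card * w x)
      = ∑ x ∈ S, Real.log (w x) - S.card * Real.log (1 / S.card) := by
    rw [Finset.sum_congr rfl fun x hx => Real.log_mul hc.ne' (hw x hx).ne', Finset.sum_add_distrib,
      Finset.sum_const, nsmul_eq_mul, one_div, Real.log_inv]
    ring
  have hr : ∑ x ∈ S, (S.card * w x - 1) = 0 := by
    rw [Finset.sum_sub_distrib, ← Finset.mul_sum, h1]; simp
  refine ⟨by linarith [Finset.sum_le_sum hle], fun heq x hx => ?_⟩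
  have he := (Finset.sum_eq_sum_iff_of_le hle).1 (by rw [hl, hr, heq, sub_self]) x hx
  by_contra hx1
  have h2 : S.card * w x ≠ 1 := fun h => hx1 (by rw [eq_div_iff hc.ne', mul_comm, h])
  exact (Real.log_lt_sub_one_of_pos (mul_pos hc (hw x hx)) h2).ne he

lemma nuisanceMean_nonneg {Θ₂ : Set (Fin 2 → ℝ)} (hΘ₂ : MeasurableSet Θ₂)
    (hsub : ∀ θ₂ ∈ Θ₂, ∀ j, 0 < θ₂ j) (j : Fin 2) : 0 ≤ nuisanceMean Θ₂ j :=
  div_nonneg (setIntegral_nonneg hΘ₂ fun θ hθ => (hsub θ hθ j).le)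
    (setIntegral_nonneg hΘ₂ fun _ _ => zero_le_one)

end BayesDesign

/-! ### Existence and uniqueness of the optimal design -/

theorem theorem4 (n : ℕ) (hn : 1 ≤ n)
    (Θ₁ : Set (Fin (n + 1) → ℝ)) (Θ₂ : Set (Fin 2 → ℝ))
    (hΘ₁ : MeasurableSet Θ₁) (hΘ₁_pos : volume Θ₁ ≠ 0) (hΘ₁_fin : volume Θ₁ ≠ ⊤)
    (hΘ₂ : MeasurableSet Θ₂) (hΘ₂_pos : volume Θ₂ ≠ 0) (hΘ₂_fin : volume Θ₂ ≠ ⊤)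
    (hΘ₂_sub : ∀ θ₂ ∈ Θ₂, ∀ j, 0 < θ₂ j)
    (hΘ₂_int : ∀ j, IntegrableOn (fun θ₂ : Fin 2 → ℝ => θ₂ j) Θ₂)
    (h_line : n = 1 →
      (BayesDesign.jacobi 2 (BayesDesign.nuisanceMean Θ₂ 0)
        (BayesDesign.nuisanceMean Θ₂ 1)).eval 0 ≠ 0) :
    (∃! ξ : BayesDesign.Design (Set.Ioo (-1) 1),
      BayesDesign.IsOptimalBB (BayesDesign.polyDensity n) Θ₁ Θ₂ (n + 1) ξ) ∧
    ∀ ξ : BayesDesign.Design (Set.Ioo (-1) 1),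
      BayesDesign.IsOptimalBB (BayesDesign.polyDensity n) Θ₁ Θ₂ (n + 1) ξ →
        ξ.support = (BayesDesign.jacobi (n + 1) (BayesDesign.nuisanceMean Θ₂ 0)
          (BayesDesign.nuisanceMean Θ₂ 1)).roots.toFinset ∧
        ∀ x ∈ ξ.support, ξ.mass x = 1 / ((n : ℝ) + 1) := by
  open BayesDesign in
  set α := nuisanceMean Θ₂ 0 with hαdef
  set β := nuisanceMean Θ₂ 1 with hβdef
  have hα : -1 < α := by linarith [nuisanceMean_nonneg hΘ₂ hΘ₂_sub 0]
  have hβ : -1 < β := by linarith [nuisanceMean_nonneg hΘ₂ hΘ₂_sub 1]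
  have hne₁ : Θ₁.Nonempty := nonempty_of_measure_ne_zero hΘ₁_pos
  have hne₂ : Θ₂.Nonempty := nonempty_of_measure_ne_zero hΘ₂_pos
  have hV : 0 < volume.real Θ₁ := ENNReal.toReal_pos hΘ₁_pos hΘ₁_fin
  obtain ⟨S, hcard, hSI, hSmax⟩ := exists_forall_jacobiEnergy_le (n + 1) hα hβ
  -- Stated for any T with energy at least that of S, so that it covers both S and the support of an
  -- arbitrary optimal design.
  have hroots {T : Finset ℝ} (hT : T.card = n + 1) (hTI : ∀ x ∈ T, x ∈ Set.Ioo (-1 : ℝ) 1)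
      (hTS : jacobiEnergy α β S ≤ jacobiEnergy α β T) :
      (jacobi (n + 1) α β).roots = T.val := by
    have := roots_jacobi_of_forall_jacobiEnergy_le β hα hTI fun U hU hUI =>
      (hSmax U (hU.trans hT) hUI).trans hTS
    rwa [hT] at this
  have hSroots := hroots hcard hSI le_rfl
  have hcardR : (S.card : ℝ) = n + 1 := by rw [hcard]; push_cast; rfl
  obtain ⟨ξ₀, hsupp₀, hmass₀⟩ := exists_uniform_design (Finset.card_pos.1 (by omega)) hSI
  have hcard₀ : ξ₀.support.card = n + 1 := by rw [hsupp₀, hcard]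
  have hns₀ : (nuisanceInfo ξ₀).det ≠ 0 := by
    -- Only n = 1 with 0 in S could leave fewer than two nonzero points, and `h_line` excludes it
    -- because S consists of roots.
    have h1 : 1 < (S.erase 0).card := by
      by_cases h0 : (0 : ℝ) ∈ S
      · rw [Finset.card_erase_of_mem h0, hcard]
        have : n ≠ 1 := by
          rintro rfl
          have : (0 : ℝ) ∈ (jacobi (1 + 1) α β).roots := by rw [hSroots]; exact h0
          exact h_line rfl (Polynomial.isRoot_of_mem_roots this)
        omega
      · rw [Finset.erase_eq_of_notMem h0, hcard]; omega
    obtain ⟨x, hx, y, hy, hxy⟩ := Finset.one_lt_card.1 h1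
    rw [Finset.mem_erase, ← hsupp₀] at hx hy
    exact nuisanceInfo_det_ne_zero hx.2 hy.2 hx.1 hy.1 hxy
  have hcrit {ξ : Design (Set.Ioo (-1) 1)} (h : ξ.support.card = n + 1)
      (hξ : IsNonsingular (polyDensity n) Θ₁ Θ₂ ξ) :=
    criterionBB_polyDensity Θ₁ hΘ₂_pos hΘ₂_fin hΘ₂_int h
      ((isNonsingular_polyDensity_iff hne₁ hne₂ h).1 hξ)
  have hle {ξ η : Design (Set.Ioo (-1) 1)} (h : ξ.support.card = n + 1)
      (hξ : IsNonsingular (polyDensity n) Θ₁ Θ₂ ξ) (h' : η.support.card = n + 1)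
      (hη : IsNonsingular (polyDensity n) Θ₁ Θ₂ η) :
      criterionBB (polyDensity n) Θ₁ Θ₂ ξ ≤ criterionBB (polyDensity n) Θ₁ Θ₂ η ↔
        ∑ x ∈ ξ.support, Real.log (ξ.mass x) + jacobiEnergy α β ξ.support ≤
          ∑ x ∈ η.support, Real.log (η.mass x) + jacobiEnergy α β η.support := by
    rw [hcrit h hξ, hcrit h' hη, mul_le_mul_iff_right₀ hV, Real.exp_le_exp,
      div_le_div_iff_of_pos_right two_pos]
  have hNS₀ := (isNonsingular_polyDensity_iff hne₁ hne₂ hcard₀).2 hns₀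
  have hlog₀ : ∑ x ∈ ξ₀.support, Real.log (ξ₀.mass x) = (n + 1) * Real.log (1 / (n + 1)) := by
    rw [hsupp₀, Finset.sum_congr rfl fun x hx => by rw [hmass₀ x hx], Finset.sum_const,
      nsmul_eq_mul, hcardR]
  have hopt₀ : IsOptimalBB (polyDensity n) Θ₁ Θ₂ (n + 1) ξ₀ := by
    refine ⟨hcard₀, hNS₀, fun η hη hηns => (hle hη hηns hcard₀ hNS₀).2 ?_⟩
    have h1 := (sum_log_le (fun x hx => η.mass_pos hx) η.sum_support).1
    rw [hη, Nat.cast_add, Nat.cast_one] at h1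
    rw [hlog₀, hsupp₀]
    -- S maximizes the energy over all (n + 1)-point sets, so the nonsingularity restriction on
    -- competitors costs nothing.
    exact add_le_add h1 (hSmax _ hη η.support_subset)
  have hprop (ξ : Design (Set.Ioo (-1) 1)) (hξ : IsOptimalBB (polyDensity n) Θ₁ Θ₂ (n + 1) ξ) :
      ξ.support = S ∧ ∀ x ∈ ξ.support, ξ.mass x = 1 / ((n : ℝ) + 1) := by
    obtain ⟨hc, hns, hmax⟩ := hξ
    have h0 := (hle hcard₀ hNS₀ hc hns).1 (hmax ξ₀ hcard₀ hNS₀)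
    have h1 := sum_log_le (fun x hx => ξ.mass_pos hx) ξ.sum_support
    rw [hc, Nat.cast_add, Nat.cast_one] at h1
    have h2 := hSmax _ hc ξ.support_subset
    rw [hlog₀, hsupp₀] at h0
    -- Optimality bounds the total below by that of `ξ₀`, while masses and energy are each bounded
    -- above by theirs; so both bounds are attained.
    have h3 := hroots hc ξ.support_subset (by linarith)
    exact ⟨Finset.val_injective (h3.symm.trans hSroots), h1.2 (by linarith)⟩
  refine ⟨⟨ξ₀, hopt₀, fun ξ hξ => ?_⟩, fun ξ hξ => ?_⟩
  · obtain ⟨hs, hm⟩ := hprop ξ hξ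
    ext x
    by_cases hx : x ∈ S
    · rw [hm x (hs ▸ hx), hmass₀ x hx, hcardR]
    · rw [Finsupp.notMem_support_iff.1 (show x ∉ ξ.mass.support from fun h => hx (hs ▸ h)),
        Finsupp.notMem_support_iff.1 (show x ∉ ξ₀.mass.support from fun h => hx (hsupp₀ ▸ h))]
  · obtain ⟨hs, hm⟩ := hprop ξ hξ
    exact ⟨by rw [hs, hSroots, Finset.val_toFinset], hm⟩
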